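/- Let $(M,g)$ be a nonempty $n$-dimensional smooth Riemannian manifold with Riemannian curvature tensor $R_{X,Y}=[\nabla_X,\nabla_Y]-\nabla_{[X,Y]}$, and let $K(u\wedge v)=g(R_{u,v}v,u)$ be the sectional curvature of the plane spanned by orthonormal vectors $u,v$. Let $\mathcal D=\mathcal D_1\oplus\mathcal D_2$ be a smooth distribution (subbundle of $TM$) which is the sum of two mutually orthogonal smooth distributions, and let $\mathcal D^\perp$ be its orthogonal complement in $TM$. For mutually orthogonal subspaces $V,W\subset T_xM$ with orthonormal bases $\{e_a\}$, $\{e'_b\}$ put $$S_{\rm m}(V,W)=\sum_{a,b}K(e_a\wedge e'_b),$$ and let $$S_{\rm mix}(\mathcal D_1,\mathcal D_2,\mathcal D^\perp)=S_{\rm m}(\mathcal D_1,\mathcal D_2)+S_{\rm m}(\mathcal D_1,\mathcal D^\perp)+S_{\rm m}(\mathcal D_2,\mathcal D^\perp);$$ these are functions on $M$. For a smooth isometric immersion $f:M\to\mathbb R^N$ with second fundamental form $\bar h$ and a subspace $V\subset T_xM$ with orthonormal basis $\{e_a\}$, put $\bar H_V=\sum_a\bar h(e_a,e_a)$. The immersion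 $f$ is called $\mathcal D$-minimal if $\bar H_{\mathcal D_x}=0$ for all $x\in M$, and minimal if $\bar H_{T_xM}=0$ for all $x\in M$. (i) If $S_{\rm m}(\mathcal D_1,\mathcal D_2)>0$ on $M$, then for no $N$ does $M$ admit a $\mathcal D$-minimal smooth isometric immersion into the Euclidean space $\mathbb R^N$. (ii) If $S_{\rm mix}(\mathcal D_1,\mathcal D_2,\mathcal D^\perp)>0$ on $M$, then for no $N$ does $M$ admit a minimal smooth isometric immersion into the Euclidean space $\mathbb R^N$. -/

import Mathlib

open Manifold Bundle
open scoped ContDiff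

namespace DistributionGeometry

noncomputable section

/-- A smooth distribution of rank `r` on an `n`-dimensional smooth manifold `M`: a rank-`r`
subbundle of `TM`, i.e. an assignment of a subspace of each tangent space which is spanned,
near every point, by `r` pointwise linearly independent smooth vector fields. -/
structure Distribution (n r : ℕ) (M : Type*) [TopologicalSpace M]
    [ChartedSpace (EuclideanSpace ℝ (Fin n)) M] [IsManifold (𝓡 n) ∞ M] where
  /-- The subspace of the tangent space at `x`. -/
  fiber : ∀ x : M, Submodule ℝ (TangentSpace (𝓡 n) x)
  exists_frame : ∀ x : M, ∃ U : Set M, IsOpen U ∧ x ∈ U ∧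
    ∃ X : Fin r → ∀ y : M, TangentSpace (𝓡 n) y,
      (∀ i, ContMDiffOn (𝓡 n) ((𝓡 n).prod 𝓘(ℝ, EuclideanSpace ℝ (Fin n))) ∞
        (fun y ↦ (⟨y, X i y⟩ : TangentBundle (𝓡 n) M)) U) ∧
      ∀ y ∈ U, LinearIndependent ℝ (fun i ↦ X i y) ∧
        Submodule.span ℝ (Set.range fun i ↦ X i y) = fiber y

/-- The trace of a bilinear map does not depend on the orthonormal basis. -/
theorem sum_diag_eq_sum_diag {V W ι κ : Type*} [NormedAddCommGroup V] [InnerProductSpace ℝ V]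
    [FiniteDimensional ℝ V] [AddCommGroup W] [Module ℝ W] [Fintype ι] [Fintype κ]
    (B : V →ₗ[ℝ] V →ₗ[ℝ] W) (b : OrthonormalBasis ι ℝ V) (c : OrthonormalBasis κ ℝ V) :
    ∑ i, B (b i) (b i) = ∑ j, B (c j) (c j) := by
  have h := (InnerProductSpace.canonicalCovariantTensor_eq_sum V b).symm.trans
    (InnerProductSpace.canonicalCovariantTensor_eq_sum V c)
  simpa using congrArg (TensorProduct.lift B) h

section Riemannian

variable {n : ℕ} {M : Type*} [TopologicalSpace M]
  [ChartedSpace (EuclideanSpace ℝ (Fin n)) M]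

/-- The coordinates of a tangent vector at `x` in the basis `∂₁, …, ∂ₙ` of the preferred chart
at `x` (Mathlib identifies `T_x M` with the model space through that chart). -/
def coord (x : M) (u : TangentSpace (𝓡 n) x) : EuclideanSpace ℝ (Fin n) := u

theorem coord_add (x : M) (u v : TangentSpace (𝓡 n) x) :
    coord x (u + v) = coord x u + coord x v := rfl

theorem coord_smul (x : M) (r : ℝ) (u : TangentSpace (𝓡 n) x) :
    coord x (r • u) = r • coord x u := rfl

theorem coord_injective (x : M) : Function.Injective (coord (n := n) x) := fun _ _ h ↦ h

/-- The vector of `T_x M` with given coordinates in the preferred chart at `x`. -/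
def ofCoord (x : M) (u : EuclideanSpace ℝ (Fin n)) : TangentSpace (𝓡 n) x := u

/-- The `i`-th coordinate vector field `∂ᵢ` of the preferred chart `φ` at `x`, at the point
`φ⁻¹ y`, i.e. `d(φ⁻¹)_y eᵢ`. -/
def coordField (x : M) (y : EuclideanSpace ℝ (Fin n)) (i : Fin n) :
    TangentSpace (𝓡 n) ((extChartAt (𝓡 n) x).symm y) :=
  mfderiv 𝓘(ℝ, EuclideanSpace ℝ (Fin n)) (𝓡 n) (extChartAt (𝓡 n) x).symm y
    (EuclideanSpace.single i (1 : ℝ) : EuclideanSpace ℝ (Fin n))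

/-- The `i`-th partial derivative of a real function of `n` variables. -/
def partialDeriv (i : Fin n) (φ : EuclideanSpace ℝ (Fin n) → ℝ)
    (y : EuclideanSpace ℝ (Fin n)) : ℝ :=
  fderiv ℝ φ y (EuclideanSpace.single i (1 : ℝ))

/-- `Γᵏᵢⱼ = ½ ∑ₗ gᵏˡ (∂ᵢ gⱼₗ + ∂ⱼ gᵢₗ - ∂ₗ gᵢⱼ)`: the Christoffel symbols of the Levi-Civita
connection of a metric with coefficient matrix `G = (gᵢⱼ)` on an open set of `ℝⁿ`. -/
def christoffel (G : EuclideanSpace ℝ (Fin n) → Matrix (Fin n) (Fin n) ℝ)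
    (k i j : Fin n) (y : EuclideanSpace ℝ (Fin n)) : ℝ :=
  1 / 2 * ∑ l, (G y)⁻¹ k l * (partialDeriv i (fun z ↦ G z j l) y
    + partialDeriv j (fun z ↦ G z i l) y - partialDeriv l (fun z ↦ G z i j) y)

/-- The components `Rˡᵢⱼₖ`, where `R(∂ᵢ, ∂ⱼ) ∂ₖ = ∑ₗ Rˡᵢⱼₖ ∂ₗ`, of the curvature tensor
`R(X, Y) = [∇_X, ∇_Y] - ∇_[X, Y]` of a metric with coefficient matrix `G`. -/
def curvatureCoeff (G : EuclideanSpace ℝ (Fin n) → Matrix (Fin n) (Fin n) ℝ)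
    (l i j k : Fin n) (y : EuclideanSpace ℝ (Fin n)) : ℝ :=
  partialDeriv i (christoffel G l j k) y - partialDeriv j (christoffel G l i k) y
    + ∑ m, (christoffel G m j k y * christoffel G l i m y
      - christoffel G m i k y * christoffel G l j m y)

variable [RiemannianBundle (fun x : M ↦ TangentSpace (𝓡 n) x)]

/-- The coefficients `gᵢⱼ = g(∂ᵢ, ∂ⱼ)` of the Riemannian metric in the preferred chart at `x`. -/
def chartMetric (x : M) (y : EuclideanSpace ℝ (Fin n)) : Matrix (Fin n) (Fin n) ℝ :=
  Matrix.of fun i j ↦ inner ℝ (coordField x y i) (coordField x y j)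

/-- The Riemannian curvature tensor `R(u, v) w` at `x`, computed in the preferred chart at `x`. -/
def curvature (x : M) (u v w : TangentSpace (𝓡 n) x) : TangentSpace (𝓡 n) x :=
  ofCoord x (WithLp.toLp 2 fun l ↦ ∑ i, ∑ j, ∑ k,
    coord x u i * coord x v j * coord x w k *
      curvatureCoeff (chartMetric x) l i j k (extChartAt (𝓡 n) x x))

/-- The sectional curvature `K(u ∧ v) = g(R(u, v) v, u)` of the plane spanned by an *orthonormal*
pair `u, v` of tangent vectors at `x`. -/
def sectionalCurvature (x : M) (u v : TangentSpace (𝓡 n) x) : ℝ :=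
  inner ℝ (curvature x u v v) u

/-- The mutual curvature `S_m(V, W) = ∑_{a,b} K(e_a ∧ e'_b)` of two orthogonal subspaces of
`T_x M`, with `e`, `e'` orthonormal bases of `V`, `W`. It does not depend on the bases, see
`mutualCurvature_eq_sum`. -/
def mutualCurvature (x : M) (V W : Submodule ℝ (TangentSpace (𝓡 n) x)) : ℝ :=
  haveI : FiniteDimensional ℝ (TangentSpace (𝓡 n) x) :=
    inferInstanceAs (FiniteDimensional ℝ (EuclideanSpace ℝ (Fin n)))
  ∑ a, ∑ b, sectionalCurvature x (stdOrthonormalBasis ℝ V a : TangentSpace (𝓡 n) x)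
    (stdOrthonormalBasis ℝ W b : TangentSpace (𝓡 n) x)

theorem coord_curvature (x : M) (u v w : TangentSpace (𝓡 n) x) (l : Fin n) :
    coord x (curvature x u v w) l = ∑ i, ∑ j, ∑ k, coord x u i * coord x v j * coord x w k *
      curvatureCoeff (chartMetric x) l i j k (extChartAt (𝓡 n) x x) := rfl

theorem curvature_add₁ (x : M) (u u' v w : TangentSpace (𝓡 n) x) :
    curvature x (u + u') v w = curvature x u v w + curvature x u' v w := by
  refine coord_injective x (PiLp.ext fun l ↦ ?_)
  simp only [coord_add, PiLp.add_apply, coord_curvature, add_mul,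
    Finset.sum_add_distrib]

theorem curvature_smul₁ (x : M) (r : ℝ) (u v w : TangentSpace (𝓡 n) x) :
    curvature x (r • u) v w = r • curvature x u v w := by
  refine coord_injective x (PiLp.ext fun l ↦ ?_)
  simp only [coord_smul, PiLp.smul_apply, smul_eq_mul, coord_curvature, Finset.mul_sum,
    mul_assoc]

theorem curvature_add₂ (x : M) (u v v' w : TangentSpace (𝓡 n) x) :
    curvature x u (v + v') w = curvature x u v w + curvature x u v' w := by
  refine coord_injective x (PiLp.ext fun l ↦ ?_)
  simp only [coord_add, PiLp.add_apply, coord_curvature, mul_add, add_mul,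
    Finset.sum_add_distrib]

theorem curvature_smul₂ (x : M) (r : ℝ) (u v w : TangentSpace (𝓡 n) x) :
    curvature x u (r • v) w = r • curvature x u v w := by
  refine coord_injective x (PiLp.ext fun l ↦ ?_)
  simp only [coord_smul, PiLp.smul_apply, smul_eq_mul, coord_curvature, Finset.mul_sum,
    mul_assoc, mul_left_comm _ r]

theorem curvature_add₃ (x : M) (u v w w' : TangentSpace (𝓡 n) x) :
    curvature x u v (w + w') = curvature x u v w + curvature x u v w' := by
  refine coord_injective x (PiLp.ext fun l ↦ ?_)
  simp only [coord_add, PiLp.add_apply, coord_curvature, mul_add, add_mul,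
    Finset.sum_add_distrib]

theorem curvature_smul₃ (x : M) (r : ℝ) (u v w : TangentSpace (𝓡 n) x) :
    curvature x u v (r • w) = r • curvature x u v w := by
  refine coord_injective x (PiLp.ext fun l ↦ ?_)
  simp only [coord_smul, PiLp.smul_apply, smul_eq_mul, coord_curvature, Finset.mul_sum,
    mul_assoc, mul_left_comm _ r]

theorem mutualCurvature_eq_sum (x : M) (V W : Submodule ℝ (TangentSpace (𝓡 n) x))
    {ι κ : Type*} [Fintype ι] [Fintype κ]
    (b : OrthonormalBasis ι ℝ V) (c : OrthonormalBasis κ ℝ W) :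
    mutualCurvature x V W = ∑ i, ∑ j, sectionalCurvature x (b i : TangentSpace (𝓡 n) x)
      (c j : TangentSpace (𝓡 n) x) := by
  have : FiniteDimensional ℝ (TangentSpace (𝓡 n) x) :=
    inferInstanceAs (FiniteDimensional ℝ (EuclideanSpace ℝ (Fin n)))
  have key₁ (v : TangentSpace (𝓡 n) x) :
      ∑ a, sectionalCurvature x (stdOrthonormalBasis ℝ V a : TangentSpace (𝓡 n) x) v =
        ∑ i, sectionalCurvature x (b i : TangentSpace (𝓡 n) x) v :=
    sum_diag_eq_sum_diag (LinearMap.mk₂ ℝ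
      (fun u u' : V ↦ inner ℝ (curvature x (u : TangentSpace (𝓡 n) x) v v)
        (u' : TangentSpace (𝓡 n) x))
      (fun u u' w ↦ by simp [curvature_add₁, inner_add_left])
      (fun r u w ↦ by simp [curvature_smul₁, inner_smul_left])
      (fun u u' w ↦ by simp [inner_add_right])
      (fun r u w ↦ by simp [inner_smul_right])) (stdOrthonormalBasis ℝ V) b
  have key₂ (u : TangentSpace (𝓡 n) x) :
      ∑ a, sectionalCurvature x u (stdOrthonormalBasis ℝ W a : TangentSpace (𝓡 n) x) =
        ∑ j, sectionalCurvature x u (c j : TangentSpace (𝓡 n) x) :=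
    sum_diag_eq_sum_diag (LinearMap.mk₂ ℝ
      (fun v v' : W ↦ inner ℝ (curvature x u (v : TangentSpace (𝓡 n) x)
        (v' : TangentSpace (𝓡 n) x)) u)
      (fun v v' w ↦ by simp [curvature_add₂, inner_add_left])
      (fun r v w ↦ by simp [curvature_smul₂, inner_smul_left])
      (fun v v' w ↦ by simp [curvature_add₃, inner_add_left])
      (fun r v w ↦ by simp [curvature_smul₃, inner_smul_left])) (stdOrthonormalBasis ℝ W) c
  unfold mutualCurvature
  simp_rw [key₂]
  rw [Finset.sum_comm]
  simp_rw [key₁]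
  rw [Finset.sum_comm]

/-- The mixed scalar curvature `S_mix(V₁, …, V_k)` of pairwise orthogonal subspaces spanning
`T_x M`: the sum of `K(e_a ∧ e_b)` over the pairs of vectors of an adapted orthonormal basis that
lie in `V_i` and `V_j` with `i < j`. -/
def mixedScalarCurvature (x : M) {k : ℕ}
    (V : Fin k → Submodule ℝ (TangentSpace (𝓡 n) x)) : ℝ :=
  ∑ i, ∑ j ∈ Finset.Ioi i, mutualCurvature x (V i) (V j)

/-- `D = D₁ ⊕ D₂` with `D₁` and `D₂` orthogonal to each other. -/
def IsOrthogonalSum [IsManifold (𝓡 n) ∞ M] {d n₁ n₂ : ℕ} (D : Distribution n d M)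
    (D₁ : Distribution n n₁ M) (D₂ : Distribution n n₂ M) : Prop :=
  ∀ x, D.fiber x = D₁.fiber x ⊔ D₂.fiber x ∧ (D₁.fiber x).IsOrtho (D₂.fiber x)

variable {N : ℕ}

/-- A smooth isometric immersion into Euclidean space: a smooth map whose differential preserves
inner products (and is therefore injective). -/
def IsIsometricImmersion (f : M → EuclideanSpace ℝ (Fin N)) : Prop :=
  ContMDiff (𝓡 n) 𝓘(ℝ, EuclideanSpace ℝ (Fin N)) ∞ f ∧
    ∀ (x : M) (u v : TangentSpace (𝓡 n) x),
      inner ℝ (mvfderiv (𝓡 n) f x u) (mvfderiv (𝓡 n) f x v) = inner ℝ u v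

/-- The second fundamental form `h̄(u, v)` at `x` of an immersion `f` into Euclidean space: the
component normal to `df(T_x M)` of the derivative, in the direction `df(u)`, of a field `df(Y)`
with `Y` a vector field extending `v`. Here `Y` is taken constant in the preferred chart `φ` at
`x`, so that the derivative is the second derivative of `f ∘ φ⁻¹` on `(u, v)`. -/
def secondFundamentalForm (f : M → EuclideanSpace ℝ (Fin N)) (x : M)
    (u v : TangentSpace (𝓡 n) x) : EuclideanSpace ℝ (Fin N) :=
  (LinearMap.range (mvfderiv (𝓡 n) f x).toLinearMap)ᗮ.starProjection
    (fderiv ℝ (fderiv ℝ (f ∘ (extChartAt (𝓡 n) x).symm)) (extChartAt (𝓡 n) x x)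
      (coord x u) (coord x v))

/-- The mean curvature vector `H̄_V = ∑_a h̄(e_a, e_a)` of a subspace `V ⊆ T_x M`, with `e` an
orthonormal basis of `V`. It does not depend on the basis, see `meanCurvature_eq_sum`. -/
def meanCurvature (f : M → EuclideanSpace ℝ (Fin N)) (x : M)
    (V : Submodule ℝ (TangentSpace (𝓡 n) x)) : EuclideanSpace ℝ (Fin N) :=
  haveI : FiniteDimensional ℝ (TangentSpace (𝓡 n) x) :=
    inferInstanceAs (FiniteDimensional ℝ (EuclideanSpace ℝ (Fin n)))
  ∑ a, secondFundamentalForm f x (stdOrthonormalBasis ℝ V a : TangentSpace (𝓡 n) x)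
    (stdOrthonormalBasis ℝ V a : TangentSpace (𝓡 n) x)

theorem meanCurvature_eq_sum (f : M → EuclideanSpace ℝ (Fin N)) (x : M)
    (V : Submodule ℝ (TangentSpace (𝓡 n) x)) {ι : Type*} [Fintype ι]
    (b : OrthonormalBasis ι ℝ V) :
    meanCurvature f x V = ∑ i, secondFundamentalForm f x (b i : TangentSpace (𝓡 n) x)
      (b i : TangentSpace (𝓡 n) x) := by
  have : FiniteDimensional ℝ (TangentSpace (𝓡 n) x) :=
    inferInstanceAs (FiniteDimensional ℝ (EuclideanSpace ℝ (Fin n)))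
  exact sum_diag_eq_sum_diag (LinearMap.mk₂ ℝ
    (fun u u' : V ↦ secondFundamentalForm f x (u : TangentSpace (𝓡 n) x)
      (u' : TangentSpace (𝓡 n) x))
    (fun u u' w ↦ by simp only [secondFundamentalForm, Submodule.coe_add, coord_add, map_add,
      add_apply])
    (fun r u w ↦ by simp only [secondFundamentalForm, Submodule.coe_smul, coord_smul, map_smul,
      smul_apply])
    (fun u u' w ↦ by simp only [secondFundamentalForm, Submodule.coe_add, coord_add, map_add])
    (fun r u w ↦ by simp only [secondFundamentalForm, Submodule.coe_smul, coord_smul, map_smul])) (stdOrthonormalBasis ℝ V) b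

/-- `f` is `D`-minimal: `H̄_D = 0` on `M`. -/
def IsDMinimal [IsManifold (𝓡 n) ∞ M] {d : ℕ} (D : Distribution n d M)
    (f : M → EuclideanSpace ℝ (Fin N)) : Prop :=
  ∀ x, meanCurvature f x (D.fiber x) = 0

/-- `f` is minimal: the mean curvature vector `H̄ = H̄_{TM}` vanishes on `M`. -/
def IsMinimal (f : M → EuclideanSpace ℝ (Fin N)) : Prop :=
  ∀ x : M, meanCurvature f x (⊤ : Submodule ℝ (TangentSpace (𝓡 n) x)) = 0

end Riemannian

end

end DistributionGeometry

open DistributionGeometry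

/-! The Gauss equation for an isometric immersion into flat space reads K(u∧v) = ⟨h̄(u,u), h̄(v,v)⟩
- |h̄(u,v)|². Dropping the square and summing over orthonormal bases gives S_m(V,W) ≤ ⟨H̄_V, H̄_W⟩
(`IsIsometricImmersion.mutualCurvature_le`). Mean curvature vectors add over orthogonal sums. Write
H₁, H₂, H₃ for those of D₁, D₂, Dᗮ. In (i), H₂ = -H₁ forces S_m ≤ -|H₁|² ≤ 0. In (ii), H₁ + H₂ + H₃
= 0 forces S_mix ≤ ∑_{i<j} ⟨Hᵢ, Hⱼ⟩ = -½ ∑ |Hᵢ|² ≤ 0. Either contradicts positivity at a single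
point.

The work lies in the Gauss equation, since curvature is defined by Christoffel symbols in a chart φ.
With F = f ∘ φ⁻¹ the metric is the Gram matrix of the ∂ᵢF, the Christoffel symbols are the
tangential coefficients of ∂ᵢ∂ⱼF, and third derivatives of F cancel in the curvature, leaving
products of normal parts (`sum_gramMatrix_mul_curvatureCoeff`). -/

namespace DistributionGeometry

noncomputable section

/-! ### The Gauss equation in coordinates -/

section Euclidean

variable {n N : ℕ}

/-- The partial derivative `∂ᵢ F` of a vector-valued function of `n` real variables. -/
def vectorPartial (i : Fin n) (F : EuclideanSpace ℝ (Fin n) → EuclideanSpace ℝ (Fin N))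
    (y : EuclideanSpace ℝ (Fin n)) : EuclideanSpace ℝ (Fin N) :=
  fderiv ℝ F y (EuclideanSpace.single i (1 : ℝ))

/-- The matrix of the metric induced by `F`, with entries `⟪∂ᵢ F, ∂ⱼ F⟫`. -/
def gramMatrix (F : EuclideanSpace ℝ (Fin n) → EuclideanSpace ℝ (Fin N))
    (y : EuclideanSpace ℝ (Fin n)) : Matrix (Fin n) (Fin n) ℝ :=
  Matrix.of fun i j ↦ inner ℝ (vectorPartial i F y) (vectorPartial j F y)

variable {F : EuclideanSpace ℝ (Fin n) → EuclideanSpace ℝ (Fin N)}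
  {s : Set (EuclideanSpace ℝ (Fin n))} {y : EuclideanSpace ℝ (Fin n)}

theorem contDiffOn_vectorPartial (hs : IsOpen s) (hF : ContDiffOn ℝ ∞ F s) (i : Fin n) :
    ContDiffOn ℝ ∞ (vectorPartial i F) s :=
  (hF.fderiv_of_isOpen hs (m := ∞) (by simp)).clm_apply contDiffOn_const

theorem differentiableAt_of_contDiffOn (hs : IsOpen s) (hF : ContDiffOn ℝ ∞ F s) (hy : y ∈ s) :
    DifferentiableAt ℝ F y :=
  (hF.contDiffAt (hs.mem_nhds hy)).differentiableAt (by simp)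

theorem fderiv_fderiv_eq_vectorPartial (hs : IsOpen s) (hF : ContDiffOn ℝ ∞ F s) (hy : y ∈ s)
    (i j : Fin n) :
    fderiv ℝ (fderiv ℝ F) y (EuclideanSpace.single i (1 : ℝ)) (EuclideanSpace.single j (1 : ℝ)) =
      vectorPartial i (vectorPartial j F) y := by
  have h : DifferentiableAt ℝ (fderiv ℝ F) y :=
    ((hF.fderiv_of_isOpen hs (m := ∞) (by simp)).contDiffAt
      (hs.mem_nhds hy)).differentiableAt (by simp)
  unfold vectorPartial
  rw [fderiv_clm_apply h (differentiableAt_const _)]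
  simp

theorem vectorPartial_comm (hs : IsOpen s) (hF : ContDiffOn ℝ ∞ F s) (hy : y ∈ s)
    (i j : Fin n) :
    vectorPartial i (vectorPartial j F) y = vectorPartial j (vectorPartial i F) y := by
  rw [← fderiv_fderiv_eq_vectorPartial hs hF hy, ← fderiv_fderiv_eq_vectorPartial hs hF hy]
  exact (hF.contDiffAt (hs.mem_nhds hy)).isSymmSndFDerivAt
    (by simpa using WithTop.coe_le_coe.2 (le_top : (2 : ℕ∞) ≤ ⊤)) _ _

theorem partialDeriv_inner {A B : EuclideanSpace ℝ (Fin n) → EuclideanSpace ℝ (Fin N)}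
    (hA : DifferentiableAt ℝ A y) (hB : DifferentiableAt ℝ B y) (m : Fin n) :
    partialDeriv m (fun z ↦ inner ℝ (A z) (B z)) y =
      inner ℝ (vectorPartial m A y) (B y) + inner ℝ (A y) (vectorPartial m B y) := by
  unfold partialDeriv vectorPartial
  rw [fderiv_inner_apply ℝ hA hB, add_comm]

theorem partialDeriv_gramMatrix (hs : IsOpen s) (hF : ContDiffOn ℝ ∞ F s) (hy : y ∈ s)
    (m i j : Fin n) :
    partialDeriv m (fun z ↦ gramMatrix F z i j) y =
      inner ℝ (vectorPartial m (vectorPartial i F) y) (vectorPartial j F y) +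
        inner ℝ (vectorPartial i F y) (vectorPartial m (vectorPartial j F) y) :=
  partialDeriv_inner (differentiableAt_of_contDiffOn hs (contDiffOn_vectorPartial hs hF i) hy)
    (differentiableAt_of_contDiffOn hs (contDiffOn_vectorPartial hs hF j) hy) m

/-- Each metric derivative splits into two inner products. By symmetry of second derivatives, four
of the six terms cancel and the other two agree, absorbing the factor ½. -/
theorem christoffel_gramMatrix (hs : IsOpen s) (hF : ContDiffOn ℝ ∞ F s) (hy : y ∈ s)
    (k i j : Fin n) :
    christoffel (gramMatrix F) k i j y = ∑ l, (gramMatrix F y)⁻¹ k l *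
      inner ℝ (vectorPartial i (vectorPartial j F) y) (vectorPartial l F y) := by
  unfold christoffel
  rw [Finset.mul_sum]
  refine Finset.sum_congr rfl fun l _ ↦ ?_
  simp only [partialDeriv_gramMatrix hs hF hy]
  rw [vectorPartial_comm hs hF hy j i, vectorPartial_comm hs hF hy l i,
    vectorPartial_comm hs hF hy l j,
    real_inner_comm (vectorPartial j F y) (vectorPartial i (vectorPartial l F) y)]
  ring

/-- The lowered form is free of the inverse matrix, so differentiating it never produces a
derivative of G⁻¹. -/
theorem sum_gramMatrix_mul_christoffel (hs : IsOpen s) (hF : ContDiffOn ℝ ∞ F s) (hy : y ∈ s)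
    (hG : (gramMatrix F y).det ≠ 0) (p i j : Fin n) :
    ∑ l, gramMatrix F y p l * christoffel (gramMatrix F) l i j y =
      inner ℝ (vectorPartial i (vectorPartial j F) y) (vectorPartial p F y) := by
  set w : Fin n → ℝ := fun l ↦
    inner ℝ (vectorPartial i (vectorPartial j F) y) (vectorPartial l F y)
  have h : (fun l ↦ christoffel (gramMatrix F) l i j y) = (gramMatrix F y)⁻¹.mulVec w :=
    funext fun l ↦ christoffel_gramMatrix hs hF hy l i j
  have h' : (gramMatrix F y).mulVec (fun l ↦ christoffel (gramMatrix F) l i j y) = w := by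
    rw [h, Matrix.mulVec_mulVec, Matrix.mul_nonsing_inv _ (isUnit_iff_ne_zero.2 hG),
      Matrix.one_mulVec]
  exact congrFun h' p

theorem differentiableAt_det {ι : Type*} [Fintype ι] [DecidableEq ι]
    {A : EuclideanSpace ℝ (Fin n) → Matrix ι ι ℝ}
    (hA : ∀ i j, DifferentiableAt ℝ (fun z ↦ A z i j) y) :
    DifferentiableAt ℝ (fun z ↦ (A z).det) y := by
  simp only [Matrix.det_apply]
  fun_prop (disch := simp [hA])

/-- Cramer's rule: each entry of the inverse is a determinant divided by det A. -/
theorem differentiableAt_inv_apply {A : EuclideanSpace ℝ (Fin n) → Matrix (Fin n) (Fin n) ℝ}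
    (hA : ∀ i j, DifferentiableAt ℝ (fun z ↦ A z i j) y) (hdet : (A y).det ≠ 0) (i j : Fin n) :
    DifferentiableAt ℝ (fun z ↦ (A z)⁻¹ i j) y := by
  simp only [Matrix.inv_def, Matrix.smul_apply, Ring.inverse_eq_inv', smul_eq_mul,
    Matrix.adjugate_apply]
  refine ((differentiableAt_det hA).inv hdet).mul (differentiableAt_det fun k l ↦ ?_)
  -- Row `j` of the matrix computing the adjugate entry is a constant unit vector; the other rows
  -- are those of `A`.
  by_cases h : k = j
  · simp [Matrix.updateRow_apply, h]
  · simpa [Matrix.updateRow_apply, h] using hA k l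

theorem differentiableAt_gramMatrix (hs : IsOpen s) (hF : ContDiffOn ℝ ∞ F s) (hy : y ∈ s)
    (i j : Fin n) : DifferentiableAt ℝ (fun z ↦ gramMatrix F z i j) y :=
  (differentiableAt_of_contDiffOn hs (contDiffOn_vectorPartial hs hF i) hy).inner ℝ
    (differentiableAt_of_contDiffOn hs (contDiffOn_vectorPartial hs hF j) hy)

theorem differentiableAt_christoffel (hs : IsOpen s) (hF : ContDiffOn ℝ ∞ F s) (hy : y ∈ s)
    (hG : (gramMatrix F y).det ≠ 0) (k i j : Fin n) :
    DifferentiableAt ℝ (christoffel (gramMatrix F) k i j) y := by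
  have h : christoffel (gramMatrix F) k i j =ᶠ[nhds y] fun z ↦ ∑ l, (gramMatrix F z)⁻¹ k l *
      inner ℝ (vectorPartial i (vectorPartial j F) z) (vectorPartial l F z) :=
    Filter.eventuallyEq_of_mem (hs.mem_nhds hy) fun z hz ↦ christoffel_gramMatrix hs hF hz k i j
  refine h.symm.differentiableAt_iff.1 (DifferentiableAt.fun_sum fun l _ ↦ ?_)
  exact (differentiableAt_inv_apply (differentiableAt_gramMatrix hs hF hy) hG k l).mul
    ((differentiableAt_of_contDiffOn hs (contDiffOn_vectorPartial hs
      (contDiffOn_vectorPartial hs hF j) i) hy).inner ℝ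
    (differentiableAt_of_contDiffOn hs (contDiffOn_vectorPartial hs hF l) hy))

/-- The product rule applied to `sum_gramMatrix_mul_christoffel`. That identity must hold near `y`,
hence nondegeneracy on all of `s`. -/
theorem sum_gramMatrix_mul_partialDeriv_christoffel (hs : IsOpen s) (hF : ContDiffOn ℝ ∞ F s)
    (hy : y ∈ s) (hG : ∀ z ∈ s, (gramMatrix F z).det ≠ 0) (m p i j : Fin n) :
    ∑ l, gramMatrix F y p l * partialDeriv m (christoffel (gramMatrix F) l i j) y =
      inner ℝ (vectorPartial m (vectorPartial i (vectorPartial j F)) y) (vectorPartial p F y) +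
      inner ℝ (vectorPartial i (vectorPartial j F) y) (vectorPartial m (vectorPartial p F) y) -
      ∑ l, (inner ℝ (vectorPartial m (vectorPartial p F) y) (vectorPartial l F y) +
        inner ℝ (vectorPartial p F y) (vectorPartial m (vectorPartial l F) y)) *
          christoffel (gramMatrix F) l i j y := by
  have h : (fun z ↦ ∑ l, gramMatrix F z p l * christoffel (gramMatrix F) l i j z) =ᶠ[nhds y]
      fun z ↦ inner ℝ (vectorPartial i (vectorPartial j F) z) (vectorPartial p F z) :=
    Filter.eventuallyEq_of_mem (hs.mem_nhds hy) fun z hz ↦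
      sum_gramMatrix_mul_christoffel hs hF hz (hG z hz) p i j
  have h' := DFunLike.congr_fun (h.fderiv_eq (𝕜 := ℝ)) (EuclideanSpace.single m (1 : ℝ))
  change partialDeriv m _ y = partialDeriv m _ y at h'
  rw [partialDeriv_inner (differentiableAt_of_contDiffOn hs (contDiffOn_vectorPartial hs
      (contDiffOn_vectorPartial hs hF j) i) hy)
    (differentiableAt_of_contDiffOn hs (contDiffOn_vectorPartial hs hF p) hy)] at h'
  rw [← h', eq_sub_iff_add_eq, ← Finset.sum_add_distrib]
  simp only [← partialDeriv_gramMatrix hs hF hy]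
  unfold partialDeriv
  rw [fderiv_fun_sum fun l _ ↦ (differentiableAt_gramMatrix hs hF hy p l).fun_mul
    (differentiableAt_christoffel hs hF hy (hG y hy) l i j)]
  rw [sum_apply]
  refine Finset.sum_congr rfl fun l _ ↦ ?_
  rw [fderiv_fun_mul (differentiableAt_gramMatrix hs hF hy p l)
    (differentiableAt_christoffel hs hF hy (hG y hy) l i j)]
  simp only [add_apply, smul_apply, smul_eq_mul]
  ring

/-- The component of `∂ᵢ ∂ⱼ F` normal to the image of `dF`, as given by the Gauss formula. -/
def normalPart (F : EuclideanSpace ℝ (Fin n) → EuclideanSpace ℝ (Fin N))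
    (y : EuclideanSpace ℝ (Fin n)) (i j : Fin n) : EuclideanSpace ℝ (Fin N) :=
  vectorPartial i (vectorPartial j F) y -
    ∑ l, christoffel (gramMatrix F) l i j y • vectorPartial l F y

theorem inner_normalPart_vectorPartial (hs : IsOpen s) (hF : ContDiffOn ℝ ∞ F s) (hy : y ∈ s)
    (hG : (gramMatrix F y).det ≠ 0) (i j p : Fin n) :
    inner ℝ (normalPart F y i j) (vectorPartial p F y) = 0 := by
  rw [normalPart, inner_sub_left, sum_inner, ← sum_gramMatrix_mul_christoffel hs hF hy hG p i j,
    sub_eq_zero]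
  refine Finset.sum_congr rfl fun l _ ↦ ?_
  rw [inner_smul_left, real_inner_comm, mul_comm]
  rfl

/-- The tangential correction in the second factor is orthogonal to the first, so only the first
needs expanding. -/
theorem inner_normalPart_normalPart (hs : IsOpen s) (hF : ContDiffOn ℝ ∞ F s) (hy : y ∈ s)
    (hG : (gramMatrix F y).det ≠ 0) (i j k l : Fin n) :
    inner ℝ (normalPart F y i j) (normalPart F y k l) =
      inner ℝ (vectorPartial i (vectorPartial j F) y) (vectorPartial k (vectorPartial l F) y) -
      ∑ m, christoffel (gramMatrix F) m i j y *
        inner ℝ (vectorPartial m F y) (vectorPartial k (vectorPartial l F) y) := by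
  conv_lhs => rw [normalPart.eq_1 F y k l]
  rw [inner_sub_right, inner_sum]
  simp only [inner_smul_right, inner_normalPart_vectorPartial hs hF hy hG, mul_zero,
    Finset.sum_const_zero, sub_zero]
  rw [normalPart, inner_sub_left, sum_inner]
  simp only [inner_smul_left, conj_trivial]

theorem normalPart_comm (hs : IsOpen s) (hF : ContDiffOn ℝ ∞ F s) (hy : y ∈ s) (i j : Fin n) :
    normalPart F y i j = normalPart F y j i := by
  simp only [normalPart, christoffel_gramMatrix hs hF hy, vectorPartial_comm hs hF hy i j]

/-- The Gauss equation in coordinates. -/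
theorem sum_gramMatrix_mul_curvatureCoeff (hs : IsOpen s) (hF : ContDiffOn ℝ ∞ F s)
    (hy : y ∈ s) (hG : ∀ z ∈ s, (gramMatrix F z).det ≠ 0) (p i j k : Fin n) :
    ∑ l, gramMatrix F y p l * curvatureCoeff (gramMatrix F) l i j k y =
      inner ℝ (normalPart F y j k) (normalPart F y i p) -
        inner ℝ (normalPart F y i k) (normalPart F y j p) := by
  -- Lowering the free index turns the outer Christoffel symbol into an inner product. Both orders
  -- of `i`, `j` are needed below.
  have hquad (i j : Fin n) :
      ∑ l, gramMatrix F y p l * ∑ m, christoffel (gramMatrix F) m j k y *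
        christoffel (gramMatrix F) l i m y = ∑ m,
        inner ℝ (vectorPartial p F y) (vectorPartial i (vectorPartial m F) y) *
          christoffel (gramMatrix F) m j k y := by
    simp only [Finset.mul_sum]
    rw [Finset.sum_comm]
    refine Finset.sum_congr rfl fun m _ ↦ ?_
    rw [real_inner_comm, ← sum_gramMatrix_mul_christoffel hs hF hy (hG y hy) p i m,
      Finset.sum_mul]
    exact Finset.sum_congr rfl fun l _ ↦ by ring
  simp only [curvatureCoeff, Finset.sum_sub_distrib, mul_add, mul_sub, Finset.sum_add_distrib,
    hquad, sum_gramMatrix_mul_partialDeriv_christoffel hs hF hy hG,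
    inner_normalPart_normalPart hs hF hy (hG y hy), add_mul]
  -- The third derivatives cancel by this symmetry. The terms pairing ∂ₚF with second derivatives
  -- cancel against `hquad`; what remains are the expanded products of normal parts.
  rw [vectorPartial_comm hs (contDiffOn_vectorPartial hs hF k) hy j i]
  simp only [mul_comm (christoffel _ _ _ _ _), real_inner_comm (vectorPartial _ F y)]
  ring

theorem inner_sum_smul_sum_smul {ι V : Type*} [Fintype ι] [NormedAddCommGroup V]
    [InnerProductSpace ℝ V] (a b : ι → ι → ℝ) (A B : ι → ι → V) :
    inner ℝ (∑ i, ∑ j, a i j • A i j) (∑ k, ∑ l, b k l • B k l) =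
      ∑ i, ∑ j, ∑ k, ∑ l, a i j * b k l * inner ℝ (A i j) (B k l) := by
  simp_rw [sum_inner, inner_sum, inner_smul_left, inner_smul_right, conj_trivial, mul_assoc]

theorem inner_sum_curvatureCoeff (hs : IsOpen s) (hF : ContDiffOn ℝ ∞ F s)
    (hy : y ∈ s) (hG : ∀ z ∈ s, (gramMatrix F z).det ≠ 0) (u v : Fin n → ℝ) :
    inner ℝ (∑ l, (∑ i, ∑ j, ∑ k, u i * v j * v k * curvatureCoeff (gramMatrix F) l i j k y) •
        vectorPartial l F y) (∑ p, u p • vectorPartial p F y) =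
      inner ℝ (∑ i, ∑ j, (u i * u j) • normalPart F y i j)
        (∑ i, ∑ j, (v i * v j) • normalPart F y i j) -
      inner ℝ (∑ i, ∑ j, (u i * v j) • normalPart F y i j)
        (∑ i, ∑ j, (u i * v j) • normalPart F y i j) := by
  have hl (p : Fin n) : ∑ l, (∑ i, ∑ j, ∑ k, u i * v j * v k *
      curvatureCoeff (gramMatrix F) l i j k y) * gramMatrix F y p l =
        ∑ i, ∑ j, ∑ k, u i * v j * v k * (inner ℝ (normalPart F y j k) (normalPart F y i p) -
          inner ℝ (normalPart F y i k) (normalPart F y j p)) := by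
    simp only [← sum_gramMatrix_mul_curvatureCoeff hs hF hy hG, Finset.sum_mul, Finset.mul_sum]
    rw [Finset.sum_comm]
    refine Finset.sum_congr rfl fun i _ ↦ ?_
    rw [Finset.sum_comm]
    refine Finset.sum_congr rfl fun j _ ↦ ?_
    rw [Finset.sum_comm]
    exact Finset.sum_congr rfl fun k _ ↦ Finset.sum_congr rfl fun l _ ↦ by ring
  -- Summation is reordered so that both indices of `u` precede both indices of `v`, as in the other
  -- product.
  have hcomm : inner ℝ (∑ i, ∑ j, (u i * v j) • normalPart F y i j)
      (∑ i, ∑ j, (u i * v j) • normalPart F y i j) = ∑ i, ∑ p, ∑ j, ∑ k,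
        u i * v k * (u p * v j) * inner ℝ (normalPart F y i k) (normalPart F y p j) := by
    rw [inner_sum_smul_sum_smul]
    exact Finset.sum_congr rfl fun i _ ↦
      Finset.sum_comm.trans (Finset.sum_congr rfl fun p _ ↦ Finset.sum_comm)
  have hLHS : inner ℝ (∑ l, (∑ i, ∑ j, ∑ k, u i * v j * v k *
      curvatureCoeff (gramMatrix F) l i j k y) • vectorPartial l F y)
      (∑ p, u p • vectorPartial p F y) = ∑ p, u p * ∑ l, (∑ i, ∑ j, ∑ k, u i * v j * v k *
        curvatureCoeff (gramMatrix F) l i j k y) * gramMatrix F y p l := by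
    rw [inner_sum]
    refine Finset.sum_congr rfl fun p _ ↦ ?_
    rw [inner_smul_right, sum_inner]
    refine congrArg _ (Finset.sum_congr rfl fun l _ ↦ ?_)
    rw [inner_smul_left, real_inner_comm]
    rfl
  rw [hLHS, hcomm, inner_sum_smul_sum_smul, ← Finset.sum_sub_distrib]
  simp only [hl, ← Finset.sum_sub_distrib, Finset.mul_sum]
  rw [Finset.sum_comm]
  refine Finset.sum_congr rfl fun i _ ↦ Finset.sum_congr rfl fun p _ ↦
    Finset.sum_congr rfl fun j _ ↦ Finset.sum_congr rfl fun k _ ↦ ?_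
  rw [normalPart_comm hs hF hy j p, real_inner_comm (normalPart F y j k)]
  ring

/-- Curvature involves derivatives of the metric, so agreement on an open set is required; the chart
metric and the Gram matrix are compared on the chart target. -/
theorem curvatureCoeff_congr {s : Set (EuclideanSpace ℝ (Fin n))} (hs : IsOpen s)
    {G G' : EuclideanSpace ℝ (Fin n) → Matrix (Fin n) (Fin n) ℝ} (h : ∀ z ∈ s, G z = G' z)
    {y : EuclideanSpace ℝ (Fin n)} (hy : y ∈ s) (l i j k : Fin n) :
    curvatureCoeff G l i j k y = curvatureCoeff G' l i j k y := by
  have hp {φ ψ : EuclideanSpace ℝ (Fin n) → ℝ} (hφ : ∀ z ∈ s, φ z = ψ z) (m : Fin n)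
      {z : EuclideanSpace ℝ (Fin n)} (hz : z ∈ s) : partialDeriv m φ z = partialDeriv m ψ z := by
    unfold partialDeriv
    rw [(Filter.eventuallyEq_of_mem (hs.mem_nhds hz) hφ).fderiv_eq]
  have hc (k i j : Fin n) {z : EuclideanSpace ℝ (Fin n)} (hz : z ∈ s) :
      christoffel G k i j z = christoffel G' k i j z := by
    unfold christoffel
    simp only [h z hz, hp (fun w hw ↦ congrFun (congrFun (h w hw) _) _) _ hz]
  unfold curvatureCoeff
  simp only [hc _ _ _ hy, hp (fun w hw ↦ hc _ _ _ hw) _ hy]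

end Euclidean

/-! ### Transfer to the manifold through the preferred chart -/

section Riemannian

variable {n N : ℕ} {M : Type*} [TopologicalSpace M]
  [ChartedSpace (EuclideanSpace ℝ (Fin n)) M]
  {f : M → EuclideanSpace ℝ (Fin N)}

theorem contDiffOn_comp_extChartAt_symm [IsManifold (𝓡 n) ∞ M]
    (hf : ContMDiff (𝓡 n) 𝓘(ℝ, EuclideanSpace ℝ (Fin N)) ∞ f) (x : M) :
    ContDiffOn ℝ ∞ (f ∘ (extChartAt (𝓡 n) x).symm) (extChartAt (𝓡 n) x).target :=
  contMDiffOn_iff_contDiffOn.1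
    (hf.comp_contMDiffOn (contMDiffOn_extChartAt_symm (n := ∞) x))

/-- At the base point of the chart the identification of the tangent space with ℝⁿ is the chart's
own, so no differential of φ⁻¹ appears. -/
theorem mvfderiv_eq_fderiv (hf : ContMDiff (𝓡 n) 𝓘(ℝ, EuclideanSpace ℝ (Fin N)) ∞ f) (x : M)
    (u : TangentSpace (𝓡 n) x) :
    mvfderiv (𝓡 n) f x u =
      fderiv ℝ (f ∘ (extChartAt (𝓡 n) x).symm) (extChartAt (𝓡 n) x x) (coord x u) := by
  have h : MDifferentiableAt (𝓡 n) 𝓘(ℝ, EuclideanSpace ℝ (Fin N)) f x :=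
    hf.mdifferentiable (by simp) x
  change mfderiv (𝓡 n) 𝓘(ℝ, EuclideanSpace ℝ (Fin N)) f x u = _
  rw [h.mfderiv]
  simp only [ModelWithCorners.range_eq_univ, fderivWithin_univ]
  rfl

theorem fderiv_comp_extChartAt_symm [IsManifold (𝓡 n) ∞ M]
    (hf : ContMDiff (𝓡 n) 𝓘(ℝ, EuclideanSpace ℝ (Fin N)) ∞ f) (x : M)
    {y : EuclideanSpace ℝ (Fin n)} (hy : y ∈ (extChartAt (𝓡 n) x).target) :
    ⇑(fderiv ℝ (f ∘ (extChartAt (𝓡 n) x).symm) y) =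
      mvfderiv (𝓡 n) f ((extChartAt (𝓡 n) x).symm y) ∘
        mfderiv 𝓘(ℝ, EuclideanSpace ℝ (Fin n)) (𝓡 n) (extChartAt (𝓡 n) x).symm y := by
  have h₁ : MDifferentiableAt 𝓘(ℝ, EuclideanSpace ℝ (Fin n)) (𝓡 n)
      (extChartAt (𝓡 n) x).symm y :=
    ((contMDiffOn_extChartAt_symm (n := ∞) x).contMDiffAt
      ((isOpen_extChartAt_target x).mem_nhds hy)).mdifferentiableAt (by simp)
  have h := mfderiv_comp y (hf.mdifferentiable (by simp) _) h₁
  rw [mfderiv_eq_fderiv] at h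
  exact congrArg DFunLike.coe h

theorem mvfderiv_coordField [IsManifold (𝓡 n) ∞ M]
    (hf : ContMDiff (𝓡 n) 𝓘(ℝ, EuclideanSpace ℝ (Fin N)) ∞ f) (x : M)
    {y : EuclideanSpace ℝ (Fin n)} (hy : y ∈ (extChartAt (𝓡 n) x).target) (i : Fin n) :
    mvfderiv (𝓡 n) f ((extChartAt (𝓡 n) x).symm y) (coordField x y i) =
      vectorPartial i (f ∘ (extChartAt (𝓡 n) x).symm) y :=
  (congrFun (fderiv_comp_extChartAt_symm hf x hy) (EuclideanSpace.single i (1 : ℝ))).symm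

theorem fderiv_apply_eq_sum (F : EuclideanSpace ℝ (Fin n) → EuclideanSpace ℝ (Fin N))
    (y u : EuclideanSpace ℝ (Fin n)) :
    fderiv ℝ F y u = ∑ i, u i • vectorPartial i F y := by
  conv_lhs => rw [← (EuclideanSpace.basisFun (Fin n) ℝ).sum_repr u]
  simp [vectorPartial]

variable [RiemannianBundle (fun x : M ↦ TangentSpace (𝓡 n) x)]

theorem IsIsometricImmersion.mvfderiv_injective (hf : IsIsometricImmersion (n := n) f) (x : M) :
    Function.Injective (mvfderiv (𝓡 n) f x) := by
  refine (injective_iff_map_eq_zero _).2 fun u hu ↦ ?_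
  have h := hf.2 x u u
  rw [hu, inner_zero_left] at h
  exact inner_self_eq_zero.1 h.symm

variable [IsManifold (𝓡 n) ∞ M]

theorem IsIsometricImmersion.chartMetric_eq (hf : IsIsometricImmersion (n := n) f) (x : M)
    {y : EuclideanSpace ℝ (Fin n)} (hy : y ∈ (extChartAt (𝓡 n) x).target) :
    chartMetric x y = gramMatrix (f ∘ (extChartAt (𝓡 n) x).symm) y := by
  ext i j
  simp only [chartMetric, gramMatrix, Matrix.of_apply]
  rw [← hf.2, mvfderiv_coordField hf.1 x hy, mvfderiv_coordField hf.1 x hy]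

/-- The ∂ᵢF are the images of the standard basis under df ∘ d(φ⁻¹), a composite of injective maps.
-/
theorem IsIsometricImmersion.linearIndependent_vectorPartial
    (hf : IsIsometricImmersion (n := n) f) (x : M)
    {y : EuclideanSpace ℝ (Fin n)} (hy : y ∈ (extChartAt (𝓡 n) x).target) :
    LinearIndependent ℝ fun i ↦ vectorPartial i (f ∘ (extChartAt (𝓡 n) x).symm) y := by
  have hinv := isInvertible_mfderivWithin_extChartAt_symm (I := 𝓡 n) hy
  rw [ModelWithCorners.range_eq_univ, mfderivWithin_univ] at hinv
  have hinj : Function.Injective (fderiv ℝ (f ∘ (extChartAt (𝓡 n) x).symm) y) := by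
    rw [fderiv_comp_extChartAt_symm hf.1 x hy]
    exact (hf.mvfderiv_injective _).comp hinv.injective
  have h := (EuclideanSpace.basisFun (Fin n) ℝ).toBasis.linearIndependent.map_injOn
    (fderiv ℝ (f ∘ (extChartAt (𝓡 n) x).symm) y).toLinearMap hinj.injOn
  simp only [Function.comp_def, OrthonormalBasis.coe_toBasis,
    EuclideanSpace.basisFun_apply] at h
  exact h

theorem IsIsometricImmersion.det_gramMatrix_ne_zero (hf : IsIsometricImmersion (n := n) f) (x : M)
    {y : EuclideanSpace ℝ (Fin n)} (hy : y ∈ (extChartAt (𝓡 n) x).target) :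
    (gramMatrix (f ∘ (extChartAt (𝓡 n) x).symm) y).det ≠ 0 :=
  (Matrix.posDef_gram_of_linearIndependent (hf.linearIndependent_vectorPartial x hy)).det_pos.ne'

/-- This matches the orthogonal projection with the Gauss formula: `normalPart` is orthogonal to the
image of df and differs from ∂ᵢ∂ⱼF by a tangential vector. -/
theorem IsIsometricImmersion.secondFundamentalForm_eq_sum (hf : IsIsometricImmersion (n := n) f)
    (x : M) (u v : TangentSpace (𝓡 n) x) :
    secondFundamentalForm f x u v = ∑ i, ∑ j, (coord x u i * coord x v j) •
      normalPart (f ∘ (extChartAt (𝓡 n) x).symm) (extChartAt (𝓡 n) x x) i j := by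
  have hs := isOpen_extChartAt_target (I := 𝓡 n) x
  have hy := mem_extChartAt_target (I := 𝓡 n) x
  have hF := contDiffOn_comp_extChartAt_symm hf.1 x
  have hG := hf.det_gramMatrix_ne_zero x hy
  have h (w : EuclideanSpace ℝ (Fin n)) :
      mvfderiv (𝓡 n) f x (ofCoord x w) =
        ∑ i, w i • vectorPartial i (f ∘ (extChartAt (𝓡 n) x).symm) (extChartAt (𝓡 n) x x) :=
    (mvfderiv_eq_fderiv hf.1 x _).trans (fderiv_apply_eq_sum _ _ _)
  have hN (i j : Fin n) : (LinearMap.range (mvfderiv (𝓡 n) f x).toLinearMap)ᗮ.starProjection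
      (vectorPartial i (vectorPartial j (f ∘ (extChartAt (𝓡 n) x).symm)) (extChartAt (𝓡 n) x x)) =
      normalPart (f ∘ (extChartAt (𝓡 n) x).symm) (extChartAt (𝓡 n) x x) i j := by
    refine Submodule.eq_starProjection_of_mem_orthogonal ?_ ?_
    · rw [Submodule.mem_orthogonal']
      rintro _ ⟨w, rfl⟩
      change inner ℝ _ (mvfderiv (𝓡 n) f x (ofCoord x (coord x w))) = 0
      rw [h, inner_sum]
      simp only [inner_smul_right, inner_normalPart_vectorPartial hs hF hy hG, mul_zero,
        Finset.sum_const_zero]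
    · rw [Submodule.orthogonal_orthogonal, normalPart, sub_sub_cancel]
      -- The tangential difference is the image of the vector whose coordinates are the Christoffel
      -- symbols.
      exact ⟨ofCoord x (WithLp.toLp 2 fun l ↦ christoffel (gramMatrix
        (f ∘ (extChartAt (𝓡 n) x).symm)) l i j (extChartAt (𝓡 n) x x)), h _⟩
  unfold secondFundamentalForm
  conv_lhs => rw [← (EuclideanSpace.basisFun (Fin n) ℝ).sum_repr (coord x u),
    ← (EuclideanSpace.basisFun (Fin n) ℝ).sum_repr (coord x v)]
  simp only [map_sum, map_smul, sum_apply, smul_apply, EuclideanSpace.basisFun_apply,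
    EuclideanSpace.basisFun_repr, fderiv_fderiv_eq_vectorPartial hs hF hy, hN, Finset.smul_sum,
    smul_smul]
  rw [Finset.sum_comm]
  simp only [mul_comm]

/-- The Gauss equation. -/
theorem IsIsometricImmersion.sectionalCurvature_eq (hf : IsIsometricImmersion (n := n) f)
    (x : M) (u v : TangentSpace (𝓡 n) x) :
    sectionalCurvature x u v =
      inner ℝ (secondFundamentalForm f x u u) (secondFundamentalForm f x v v) -
        inner ℝ (secondFundamentalForm f x u v) (secondFundamentalForm f x u v) := by
  have hs := isOpen_extChartAt_target (I := 𝓡 n) x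
  have hy := mem_extChartAt_target (I := 𝓡 n) x
  have hF := contDiffOn_comp_extChartAt_symm hf.1 x
  have hG (z) (hz : z ∈ (extChartAt (𝓡 n) x).target) := hf.det_gramMatrix_ne_zero x hz
  unfold sectionalCurvature
  rw [← hf.2, mvfderiv_eq_fderiv hf.1, mvfderiv_eq_fderiv hf.1, fderiv_apply_eq_sum,
    fderiv_apply_eq_sum]
  simp only [hf.secondFundamentalForm_eq_sum, coord_curvature,
    curvatureCoeff_congr hs (fun z hz ↦ hf.chartMetric_eq x hz) hy]
  -- What remains is a statement about a map between Euclidean spaces and two coordinate vectors.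
  generalize f ∘ (extChartAt (𝓡 n) x).symm = F at *
  generalize extChartAt (𝓡 n) x x = y at *
  generalize coord x u = u at *
  generalize coord x v = v at *
  exact inner_sum_curvatureCoeff hs hF hy hG u v

end Riemannian

/-- Orthonormal bases of two orthogonal subspaces together form an orthonormal basis of their
sum. -/
theorem exists_orthonormalBasis_sup {E ι κ : Type*} [NormedAddCommGroup E] [InnerProductSpace ℝ E]
    [Fintype ι] [Fintype κ] {V W : Submodule ℝ E} (h : V.IsOrtho W)
    (b : OrthonormalBasis ι ℝ V) (c : OrthonormalBasis κ ℝ W) :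
    ∃ e : OrthonormalBasis (ι ⊕ κ) ℝ ↥(V ⊔ W),
      (∀ i, (e (Sum.inl i) : E) = b i) ∧ ∀ j, (e (Sum.inr j) : E) = c j := by
  classical
  let v : ι ⊕ κ → ↥(V ⊔ W) := Sum.elim (fun i ↦ Submodule.inclusion le_sup_left (b i))
    (fun j ↦ Submodule.inclusion le_sup_right (c j))
  have hv : Orthonormal ℝ v := by
    rw [orthonormal_iff_ite]
    have hb := orthonormal_iff_ite.1 b.orthonormal
    have hc := orthonormal_iff_ite.1 c.orthonormal
    rintro (i | i) (j | j)
    · simpa [v] using hb i j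
    · simpa [v] using h.inner_eq (b i).2 (c j).2
    · simpa [v] using h.symm.inner_eq (c i).2 (b j).2
    · simpa [v] using hc i j
  have hspan : ⊤ ≤ Submodule.span ℝ (Set.range v) := by
    have hb : Submodule.span ℝ (Set.range fun i ↦ (b i : E)) = V := by
      have := congrArg (Submodule.map V.subtype) b.toBasis.span_eq
      rw [Submodule.map_span, ← Set.range_comp, Submodule.map_subtype_top] at this
      simpa [Function.comp_def] using this
    have hc : Submodule.span ℝ (Set.range fun j ↦ (c j : E)) = W := by
      have := congrArg (Submodule.map W.subtype) c.toBasis.span_eq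
      rw [Submodule.map_span, ← Set.range_comp, Submodule.map_subtype_top] at this
      simpa [Function.comp_def] using this
    rw [← Submodule.map_le_map_iff_of_injective (V ⊔ W).subtype_injective,
      Submodule.map_subtype_top, Submodule.map_span, ← Set.range_comp]
    refine sup_le ?_ ?_
    · refine hb.ge.trans (Submodule.span_mono ?_)
      rintro _ ⟨i, rfl⟩
      exact ⟨Sum.inl i, rfl⟩
    · refine hc.ge.trans (Submodule.span_mono ?_)
      rintro _ ⟨j, rfl⟩
      exact ⟨Sum.inr j, rfl⟩
  exact ⟨OrthonormalBasis.mk hv hspan, fun i ↦ by simp [v], fun j ↦ by simp [v]⟩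

/-! ### Mutual curvature bounded by mean curvature vectors -/

section Riemannian

variable {n N : ℕ} {M : Type*} [TopologicalSpace M]
  [ChartedSpace (EuclideanSpace ℝ (Fin n)) M]
  {f : M → EuclideanSpace ℝ (Fin N)}
  [RiemannianBundle (fun x : M ↦ TangentSpace (𝓡 n) x)]

theorem meanCurvature_sup (f : M → EuclideanSpace ℝ (Fin N)) (x : M)
    {V W : Submodule ℝ (TangentSpace (𝓡 n) x)} (h : V.IsOrtho W) :
    meanCurvature f x (V ⊔ W) = meanCurvature f x V + meanCurvature f x W := by
  have : FiniteDimensional ℝ (TangentSpace (𝓡 n) x) :=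
    inferInstanceAs (FiniteDimensional ℝ (EuclideanSpace ℝ (Fin n)))
  obtain ⟨e, hb, hc⟩ :=
    exists_orthonormalBasis_sup h (stdOrthonormalBasis ℝ V) (stdOrthonormalBasis ℝ W)
  rw [meanCurvature_eq_sum f x _ e, meanCurvature_eq_sum f x V (stdOrthonormalBasis ℝ V),
    meanCurvature_eq_sum f x W (stdOrthonormalBasis ℝ W), Fintype.sum_sum_type]
  simp only [hb, hc]

theorem IsIsometricImmersion.mutualCurvature_le [IsManifold (𝓡 n) ∞ M]
    (hf : IsIsometricImmersion (n := n) f) (x : M) (V W : Submodule ℝ (TangentSpace (𝓡 n) x)) :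
    mutualCurvature x V W ≤ inner ℝ (meanCurvature f x V) (meanCurvature f x W) := by
  unfold mutualCurvature meanCurvature
  simp_rw [sum_inner, inner_sum, hf.sectionalCurvature_eq]
  refine Finset.sum_le_sum fun a _ ↦ Finset.sum_le_sum fun b _ ↦ ?_
  -- The discarded term of the Gauss equation is |h̄(e_a, e'_b)|².
  rw [sub_le_self_iff]
  exact real_inner_self_nonneg

end Riemannian

end

end DistributionGeometry

/-! ### Contradiction at one point -/

theorem mainTheorem10 {n d n₁ n₂ : ℕ} {M : Type*} [TopologicalSpace M] [Nonempty M]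
    [ChartedSpace (EuclideanSpace ℝ (Fin n)) M] [IsManifold (𝓡 n) ∞ M]
    [RiemannianBundle (fun x : M ↦ TangentSpace (𝓡 n) x)]
    [IsContMDiffRiemannianBundle (𝓡 n) ∞ (EuclideanSpace ℝ (Fin n))
      (fun x : M ↦ TangentSpace (𝓡 n) x)]
    (D : Distribution n d M) (D₁ : Distribution n n₁ M) (D₂ : Distribution n n₂ M)
    (hD : IsOrthogonalSum D D₁ D₂) :
    ((∀ x, 0 < mutualCurvature x (D₁.fiber x) (D₂.fiber x)) →
      ∀ (N : ℕ) (f : M → EuclideanSpace ℝ (Fin N)),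
        IsIsometricImmersion (n := n) f → ¬ IsDMinimal D f) ∧
    ((∀ x, 0 < mixedScalarCurvature x ![D₁.fiber x, D₂.fiber x, (D.fiber x)ᗮ]) →
      ∀ (N : ℕ) (f : M → EuclideanSpace ℝ (Fin N)),
        IsIsometricImmersion (n := n) f → ¬ IsMinimal (n := n) f) := by
  obtain ⟨x⟩ := ‹Nonempty M›
  have : FiniteDimensional ℝ (TangentSpace (𝓡 n) x) :=
    inferInstanceAs (FiniteDimensional ℝ (EuclideanSpace ℝ (Fin n)))
  obtain ⟨hsup, hortho⟩ := hD x
  refine ⟨fun hpos N f hf hmin ↦ ?_, fun hpos N f hf hmin ↦ ?_⟩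
  · have h := hmin x
    rw [hsup, meanCurvature_sup f x hortho] at h
    have hle := (hpos x).trans_le (hf.mutualCurvature_le x _ _)
    -- Substituting H₂ = -H₁ bounds the mutual curvature by -|H₁|².
    rw [eq_neg_of_add_eq_zero_right h, inner_neg_right] at hle
    linarith [real_inner_self_nonneg (x := meanCurvature f x (D₁.fiber x))]
  · have h := hmin x
    rw [← Submodule.sup_orthogonal_of_hasOrthogonalProjection (K := D.fiber x),
      meanCurvature_sup f x (Submodule.isOrtho_orthogonal_right _)] at h
    -- Only the first occurrence is split; the one inside the orthogonal complement stays.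
    nth_rw 1 [hsup] at h
    rw [meanCurvature_sup f x hortho] at h
    have hpos := hpos x
    have hmix : mixedScalarCurvature x ![D₁.fiber x, D₂.fiber x, (D.fiber x)ᗮ] =
        mutualCurvature x (D₁.fiber x) (D₂.fiber x) +
        mutualCurvature x (D₁.fiber x) (D.fiber x)ᗮ +
        mutualCurvature x (D₂.fiber x) (D.fiber x)ᗮ := by
      have h₀ : Finset.Ioi (0 : Fin 3) = {1, 2} := by decide
      have h₁ : Finset.Ioi (1 : Fin 3) = {2} := by decide
      have h₂ : Finset.Ioi (2 : Fin 3) = ∅ := by decide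
      simp [mixedScalarCurvature, Fin.sum_univ_three, h₀, h₁, h₂]
    have h₁₂ := hf.mutualCurvature_le x (D₁.fiber x) (D₂.fiber x)
    have h₁₃ := hf.mutualCurvature_le x (D₁.fiber x) (D.fiber x)ᗮ
    have h₂₃ := hf.mutualCurvature_le x (D₂.fiber x) (D.fiber x)ᗮ
    rw [eq_neg_of_add_eq_zero_right h] at h₁₃ h₂₃
    simp only [inner_neg_right, inner_add_right] at h₁₃ h₂₃
    rw [real_inner_comm] at h₂₃
    -- With H₃ = -(H₁ + H₂), the three bounds add up to -|H₁|² - |H₂|² - ⟨H₁, H₂⟩ = -½ (|H₁ + H₂|² +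
    -- |H₁|² + |H₂|²).
    have hsq := real_inner_self_nonneg
      (x := meanCurvature f x (D₁.fiber x) + meanCurvature f x (D₂.fiber x))
    rw [real_inner_add_add_self] at hsq
    linarith [real_inner_self_nonneg (x := meanCurvature f x (D₁.fiber x)),
      real_inner_self_nonneg (x := meanCurvature f x (D₂.fiber x))]
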